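/- For $n\ge 1$ and $|z|<1$ let $\mathrm{Li}_n(z)=\sum_{k\ge 1} z^k/k^n$, and define the real numbers $$C_n=\Re\left\{\left(\tfrac23\right)^{n-1}\mathrm{Li}_n\!\left(\tfrac{i}{\sqrt8}\right)-2^n\,\mathrm{Li}_n\!\left(\tfrac{-i}{\sqrt2}\right)\right\},\qquad D_n=\Re\left\{\left(\tfrac23\right)^{n-1}\mathrm{Li}_n\!\left(\tfrac{1+i}{4}\right)-\mathrm{Li}_n\!\left(\tfrac{-i}{2}\right)\right\}.$$ Let ${}_3F_2(a_1,a_2,a_3;b_1,b_2;z)=\sum_{k\ge0}\frac{(a_1)_k(a_2)_k(a_3)_k}{(b_1)_k(b_2)_k\,k!}z^k$ with $(a)_k=a(a+1)\cdots(a+k-1)$. (1) The series ${}_3F_2(-\tfrac t2,\tfrac12-\tfrac t6,1;1-\tfrac t2,1-\tfrac{2t}3;1)$ converges for every complex $t$ with $\Re t<1$ and is a holomorphic function of $t$ there; for $|t|<1$ the series $\sum_{n\ge1}C_nt^n$ converges and $$2\sum_{n\ge1}C_nt^n=1-{}_3F_2\!\left(-\tfrac t2,\ \tfrac12-\tfrac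 t6,\ 1;\ 1-\tfrac t2,\ 1-\tfrac{2t}3;\ 1\right).$$ (2) The series ${}_3F_2(-\tfrac t2,\tfrac12-\tfrac t3,1;1-\tfrac t2,1-\tfrac{2t}3;1)$ converges for every complex $t$ with $\Re t<\tfrac32$ and is a holomorphic function of $t$ there; for $|t|<\tfrac32$ the series $\sum_{n\ge1}D_nt^n$ converges and $$2\sum_{n\ge1}D_nt^n=1-{}_3F_2\!\left(-\tfrac t2,\ \tfrac12-\tfrac t3,\ 1;\ 1-\tfrac t2,\ 1-\tfrac{2t}3;\ 1\right).$$ -/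

import Mathlib

noncomputable section

/-- The polylogarithm `Li_n(z) = ∑_{k > 0} z ^ k / k ^ n`; it is used only at points with
`‖z‖ < 1`, where the series converges absolutely. -/
def polyLi (n : ℕ) (z : ℂ) : ℂ :=
  ∑' k : ℕ, z ^ (k + 1) / ((k : ℂ) + 1) ^ n

/-- The ladder `C_n = Re {(2/3)^(n-1) Li_n(i/√8) - 2^n Li_n(-i/√2)}`. -/
def ladderC (n : ℕ) : ℝ :=
  (((2 / 3 : ℂ) ^ ((n : ℤ) - 1)) * polyLi n (Complex.I / (Real.sqrt 8 : ℂ))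
    - (2 : ℂ) ^ n * polyLi n (-Complex.I / (Real.sqrt 2 : ℂ))).re

/-- The ladder `D_n = Re {(2/3)^(n-1) Li_n((1+i)/4) - Li_n(-i/2)}`. -/
def ladderD (n : ℕ) : ℝ :=
  (((2 / 3 : ℂ) ^ ((n : ℤ) - 1)) * polyLi n ((1 + Complex.I) / 4)
    - polyLi n (-Complex.I / 2)).re

/-- The `k`-th term of the hypergeometric series `₃F₂(a₁, a₂, a₃; b₁, b₂; z)`, where
`(ascPochhammer ℂ k).eval a = a (a + 1) ⋯ (a + k - 1)`. -/
def hyp3F2Term (a₁ a₂ a₃ b₁ b₂ z : ℂ) (k : ℕ) : ℂ :=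
  ((ascPochhammer ℂ k).eval a₁ * (ascPochhammer ℂ k).eval a₂ * (ascPochhammer ℂ k).eval a₃) /
    ((ascPochhammer ℂ k).eval b₁ * (ascPochhammer ℂ k).eval b₂ * (k.factorial : ℂ)) * z ^ k

/-- The hypergeometric series `₃F₂(a₁, a₂, a₃; b₁, b₂; z)`. -/
def hyp3F2 (a₁ a₂ a₃ b₁ b₂ z : ℂ) : ℂ :=
  ∑' k : ℕ, hyp3F2Term a₁ a₂ a₃ b₁ b₂ z k

end

noncomputable section

open Filter Topology Finset

/-! Both sides are holomorphic in `t` on the disc, so it is enough to compare them at `t = -6v` with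
`v > 0`, points that accumulate at `0`.

There the hypergeometric series becomes `6v ∑ (a)_k / ((b)_k (2k + 6v))` with `b = 1 + 4v` and `a =
1/2 + v` or `1/2 + 2v`. Replacing `v` by `v + 1` turns the denominator at `j` into the one at `j +
3`, and a rational certificate (`termC_telescope`, `termD_telescope`) makes the sum satisfy a
first-order recurrence in `v` with factor `1/64` or `-1/64`.

On the other side, a purely imaginary argument `z` reduces `Re Li_n(z)` to `2^(-n) Li_n(z^2)`, and
summing over `n` first turns each generating function into `1 - x ∑ w_k / (k + x)`. These Lerch sums
obey the same recurrence, because `(-1/8)^2 = (-1/2)^6 = 1/64` and `(-1/4)^3 = ((1+i)/4)^4 = -1/64`.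

The difference of the two sides therefore solves a homogeneous equation `f v = c * f (v + 1)` with
`|c| < 1`; it is bounded along `v + n`, hence zero (`eq_zero_of_shift`). This gives `tsum_termC` and
`tsum_termD`; the identity theorem does the rest. -/

/-! ### Decay of quotients of Pochhammer symbols. -/

/-- The quotient `(a)_k / (b)_k` of Pochhammer symbols, as a product of `k` factors. -/
def pochRatio {K : Type*} [Field K] (a b : K) (k : ℕ) : K :=
  ∏ j ∈ range k, (a + j) / (b + j)

lemma pochRatio_zero {K : Type*} [Field K] (a b : K) : pochRatio a b 0 = 1 := by
  simp [pochRatio]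

lemma pochRatio_succ {K : Type*} [Field K] (a b : K) (k : ℕ) :
    pochRatio a b (k + 1) = pochRatio a b k * ((a + k) / (b + k)) := by
  rw [pochRatio, prod_range_succ, pochRatio]

lemma ofReal_pochRatio (a b : ℝ) (k : ℕ) :
    ((pochRatio a b k : ℝ) : ℂ) = pochRatio (a : ℂ) (b : ℂ) k := by
  simp [pochRatio]

/-- Bernoulli gives `(1 + 1/x)^c ≤ 1 + c/x`, and `(1 - c/x)(1 + c/x) ≤ 1`. The right side is a ratio
of consecutive powers, so products of such bounds telescope. -/
lemma one_sub_div_le_rpow {c x : ℝ} (hc : 0 ≤ c) (hc1 : c ≤ 1) (hx : 0 < x) :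
    1 - c / x ≤ x ^ c * (x + 1) ^ (-c) := by
  have hx1 : 0 < x + 1 := by linarith
  have h1 : (1 + 1 / x) ^ c ≤ 1 + c * (1 / x) :=
    rpow_one_add_le_one_add_mul_self (by have := one_div_pos.2 hx; linarith) hc hc1
  have h2 : (1 + 1 / x) = (x + 1) / x := by field_simp
  rw [h2, Real.div_rpow hx1.le hx.le] at h1
  rw [Real.rpow_neg hx1.le]
  have hA : 0 < x ^ c := Real.rpow_pos_of_pos hx c
  have hB : 0 < (x + 1) ^ c := Real.rpow_pos_of_pos hx1 c
  rw [div_le_iff₀ hA] at h1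
  rw [← div_eq_mul_inv, le_div_iff₀ hB]
  rcases le_or_gt (1 - c / x) 0 with h | h
  · nlinarith
  · have h3 : (1 - c / x) * (1 + c * (1 / x)) ≤ 1 := by
      have : c * (1 / x) = c / x := by ring
      rw [this]; nlinarith [sq_nonneg (c / x)]
    nlinarith [mul_le_mul_of_nonneg_left h1 h.le]

/-- Far to the right the imaginary part of `a` is negligible: it adds at most `σ / 2` to the
modulus, half of the gap `σ` between the real parts. -/
lemma norm_add_natCast_le {a b : ℂ} {M σ : ℝ} (hσ : 0 < σ) (ha : ‖a‖ ≤ M)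
    (hab : σ ≤ (b - a).re) {j : ℕ} (hj : M + M ^ 2 / σ ≤ j) :
    ‖a + j‖ ≤ ‖b + j‖ - σ / 2 := by
  have hre : -M ≤ a.re := by
    have := abs_le.1 ((Complex.abs_re_le_norm a).trans ha); exact this.1
  have him : a.im ^ 2 ≤ M ^ 2 := by
    have := (Complex.abs_im_le_norm a).trans ha
    exact sq_le_sq.2 (this.trans (le_abs_self _))
  have hx : M ^ 2 / σ ≤ a.re + j := by linarith
  have hx0 : 0 ≤ a.re + j := le_trans (by positivity) hx
  rw [div_le_iff₀ hσ] at hx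
  have h1 : ‖a + j‖ ≤ a.re + j + σ / 2 := by
    refine abs_le_of_sq_le_sq' ?_ (by linarith) |>.2
    rw [← Complex.normSq_eq_norm_sq, Complex.normSq_apply]
    simp
    nlinarith
  have h2 : b.re + j ≤ ‖b + j‖ := by
    simpa using Complex.re_le_norm (b + j)
  simp at hab
  linarith

/-- Uniform polynomial decay of `(a)_k / (b)_k` when `Re (b - a)` is bounded below. -/
lemma exists_norm_pochRatio_le (M σ : ℝ) (hM : 1 ≤ M) (hσ : 0 < σ) :
    ∃ c : ℝ, 0 < c ∧ ∃ C : ℝ, 0 ≤ C ∧ ∀ a b : ℂ, ‖a‖ ≤ M → ‖b‖ ≤ M → σ ≤ b.re →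
      σ ≤ (b - a).re → ∀ k : ℕ, ‖pochRatio a b k‖ ≤ C * ((k : ℝ) + M) ^ (-c) := by
  -- `σ / 2` is the gain per factor from `norm_add_natCast_le`; the cap `1` is what Bernoulli's
  -- inequality needs.
  set c : ℝ := min (σ / 2) 1 with hc
  have hc0 : 0 < c := lt_min (by linarith) one_pos
  obtain ⟨J, hJ⟩ := exists_nat_ge (M + M ^ 2 / σ)
  -- A crude bound, uniform in `a` and `b`, for the indices up to `J`, where the factors need not be
  -- below `1`.
  set B : ℕ → ℝ := fun k => ∏ j ∈ range k, ((M + j) / σ) with hB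
  have hB0 : ∀ k, 0 ≤ B k := fun k => prod_nonneg fun j _ => by positivity
  have hw : ∀ k : ℕ, 0 < (k : ℝ) + M := fun k => by positivity
  have hC0 : ∀ k ∈ range (J + 1), 0 ≤ B k * ((k : ℝ) + M) ^ c := fun k _ =>
    mul_nonneg (hB0 k) (Real.rpow_nonneg (hw k).le _)
  refine ⟨c, hc0, ∑ k ∈ range (J + 1), B k * ((k : ℝ) + M) ^ c, sum_nonneg hC0, ?_⟩
  intro a b ha hb hbσ hab
  have hbj : ∀ j : ℕ, σ ≤ ‖b + j‖ := fun j => by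
    have h2 : b.re + j ≤ ‖b + j‖ := by simpa using Complex.re_le_norm (b + j)
    have : (0 : ℝ) ≤ j := by positivity
    linarith
  have hpB : ∀ k, ‖pochRatio a b k‖ ≤ B k := fun k => by
    rw [pochRatio, norm_prod]
    refine prod_le_prod (fun _ _ => norm_nonneg _) fun j _ => ?_
    rw [norm_div]
    have : ‖a + j‖ ≤ M + j := (norm_add_le _ _).trans (by simpa using ha)
    exact div_le_div₀ (by positivity) this hσ (hbj j)
  have hsmall : ∀ k ≤ J, ‖pochRatio a b k‖ ≤
      (∑ k ∈ range (J + 1), B k * ((k : ℝ) + M) ^ c) * ((k : ℝ) + M) ^ (-c) := fun k hk => by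
    have h := single_le_sum hC0 (mem_range.2 (Nat.lt_succ_of_le hk))
    refine (hpB k).trans ?_
    calc B k = B k * ((k : ℝ) + M) ^ c * ((k : ℝ) + M) ^ (-c) := by
          rw [mul_assoc, ← Real.rpow_add (hw k)]; simp
      _ ≤ _ := mul_le_mul_of_nonneg_right h (Real.rpow_nonneg (hw k).le _)
  intro k
  rcases le_total k J with hk | hk
  · exact hsmall k hk
  · induction k, hk using Nat.le_induction with
    | base => exact hsmall J le_rfl
    | succ k hk ih =>
      rw [pochRatio_succ, norm_mul]
      have hMk : M + M ^ 2 / σ ≤ (k : ℝ) := hJ.trans (by exact_mod_cast hk)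
      have h1 := norm_add_natCast_le hσ ha hab hMk
      have hbk : 0 < ‖b + k‖ := hσ.trans_le (hbj k)
      have h2 : ‖(a + k) / (b + k)‖ ≤ 1 - c / ((k : ℝ) + M) := by
        have hbM : ‖b + k‖ ≤ (k : ℝ) + M := (norm_add_le _ _).trans (by simp; linarith)
        have h3 : c / ((k : ℝ) + M) ≤ (σ / 2) / ‖b + k‖ :=
          div_le_div₀ (by linarith) (min_le_left _ _) hbk hbM
        rw [norm_div]
        have h4 : ‖a + k‖ / ‖b + k‖ ≤ (‖b + k‖ - σ / 2) / ‖b + k‖ := by gcongr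
        rw [sub_div, div_self hbk.ne'] at h4
        linarith
      have h5 := h2.trans (one_sub_div_le_rpow hc0.le (min_le_right _ _) (hw k))
      refine (mul_le_mul ih h5 (norm_nonneg _) ?_).trans (le_of_eq ?_)
      · exact mul_nonneg (sum_nonneg hC0) (Real.rpow_nonneg (hw k).le _)
      · have : ((k : ℝ) + M) ^ (-c) * ((k : ℝ) + M) ^ c = 1 := by
          rw [← Real.rpow_add (hw k)]; simp
        push_cast
        rw [show (k : ℝ) + 1 + M = k + M + 1 by ring]
        linear_combination (∑ k ∈ range (J + 1), B k * ((k : ℝ) + M) ^ c) *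
          ((k : ℝ) + M + 1) ^ (-c) * this

/-- `(a)_k / (b)_k` divided by `k + 1` has a summable bound that is uniform in `a` and `b`. -/
lemma exists_summable_bound_pochRatio (M σ : ℝ) (hM : 1 ≤ M) (hσ : 0 < σ) :
    ∃ w : ℕ → ℝ, Summable w ∧ ∀ a b : ℂ, ‖a‖ ≤ M → ‖b‖ ≤ M → σ ≤ b.re →
      σ ≤ (b - a).re → ∀ k : ℕ, ‖pochRatio a b k‖ / ((k : ℝ) + 1) ≤ w k := by
  obtain ⟨c, hc, C, hC, h⟩ := exists_norm_pochRatio_le M σ hM hσ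
  refine ⟨fun k => C * ((k : ℝ) + 1) ^ (-(1 + c)), ?_, ?_⟩
  · have h1 : Summable fun n : ℕ => (n : ℝ) ^ (-(1 + c)) :=
      Real.summable_nat_rpow.2 (by linarith)
    have h2 := (summable_nat_add_iff 1).2 h1
    push_cast at h2
    exact h2.mul_left C
  · intro a b ha hb hbσ hab k
    have hk : (0 : ℝ) < (k : ℝ) + 1 := by positivity
    have h1 : ((k : ℝ) + M) ^ (-c) ≤ ((k : ℝ) + 1) ^ (-c) :=
      Real.rpow_le_rpow_of_nonpos hk (by linarith) (by linarith)
    have h2 := (h a b ha hb hbσ hab k).trans (mul_le_mul_of_nonneg_left h1 hC)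
    rw [div_le_iff₀ hk]
    refine h2.trans (le_of_eq ?_)
    rw [mul_assoc, ← Real.rpow_add_one hk.ne']
    congr 2; ring

lemma tendsto_pochRatio_zero {a b : ℂ} (hb : 0 < b.re) (hab : 0 < (b - a).re) :
    Tendsto (pochRatio a b) atTop (𝓝 0) := by
  obtain ⟨c, hc, C, hC, h⟩ := exists_norm_pochRatio_le (max 1 (max ‖a‖ ‖b‖))
    (min b.re (b - a).re) (le_max_left _ _) (lt_min hb hab)
  refine squeeze_zero_norm (fun k => h a b ?_ ?_ (min_le_left _ _) (min_le_right _ _) k) ?_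
  · exact (le_max_left _ _).trans (le_max_right _ _)
  · exact (le_max_right _ _).trans (le_max_right _ _)
  · have h1 := (tendsto_rpow_neg_atTop hc).comp
      (tendsto_atTop_add_const_right _ (max 1 (max ‖a‖ ‖b‖)) tendsto_natCast_atTop_atTop)
    simpa using h1.const_mul C

/-! ### Simplified form of the hypergeometric terms. -/

lemma ascPochhammer_eval_mul_add (s : ℂ) (k : ℕ) :
    (ascPochhammer ℂ k).eval s * (s + k) = s * (ascPochhammer ℂ k).eval (s + 1) := by
  rw [← ascPochhammer_succ_eval, ascPochhammer_succ_left]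
  simp

lemma pochRatio_eq_div (a b : ℂ) (k : ℕ) :
    pochRatio a b k = (ascPochhammer ℂ k).eval a / (ascPochhammer ℂ k).eval b := by
  induction k with
  | zero => simp [pochRatio]
  | succ k ih => rw [pochRatio_succ, ih, ascPochhammer_succ_eval, ascPochhammer_succ_eval,
      div_mul_div_comm]

lemma hyp3F2Term_zero (a₁ a₂ a₃ b₁ b₂ z : ℂ) : hyp3F2Term a₁ a₂ a₃ b₁ b₂ z 0 = 1 := by
  simp [hyp3F2Term]

/-- `(s)_k / (s + 1)_k = s / (s + k)` and `(1)_k = k!`. The cross-multiplied form avoids the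
quotient `0 / 0` at `s = 0`, `k = 0`. -/
lemma hyp3F2Term_mul (s a b : ℂ) (hs : -1 < s.re) (k : ℕ) :
    hyp3F2Term s a 1 (s + 1) b 1 k * (s + k) = s * pochRatio a b k := by
  have h0 : (ascPochhammer ℂ k).eval (s + 1) ≠ 0 := by
    rw [Ne, ascPochhammer_eval_eq_zero_iff]
    rintro ⟨j, -, hj⟩
    have := congrArg Complex.re hj
    simp at this
    have : (0 : ℝ) ≤ j := by positivity
    linarith
  have h1 : (k.factorial : ℂ) ≠ 0 := by exact_mod_cast k.factorial_ne_zero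
  have h2 := ascPochhammer_eval_mul_add s k
  rw [hyp3F2Term, pochRatio_eq_div, ascPochhammer_eval_one, one_pow, mul_one,
    mul_div_mul_right _ _ h1, mul_div_mul_comm, mul_right_comm, div_mul_eq_mul_div, h2,
    mul_div_assoc, div_self h0, mul_one]

lemma hyp3F2Term_succ (t a b : ℂ) (ht : t.re < 2) (k : ℕ) :
    hyp3F2Term (-t / 2) a 1 (1 - t / 2) b 1 (k + 1) =
      -(t / (2 * ((k : ℂ) + 1) - t)) * pochRatio a b (k + 1) := by
  have hs : -1 < (-t / 2).re := by simp; linarith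
  have h := hyp3F2Term_mul (-t / 2) a b hs (k + 1)
  rw [show -t / 2 + 1 = 1 - t / 2 by ring] at h
  have h0 : 2 * ((k : ℂ) + 1) - t ≠ 0 := by
    intro h0
    have := congrArg Complex.re h0
    simp at this
    have : (0 : ℝ) ≤ k := by positivity
    linarith
  rw [neg_mul, div_mul_eq_mul_div, ← neg_div, eq_div_iff h0]
  push_cast at h
  linear_combination 2 * h

lemma half_add_one_le_norm_sub {t : ℂ} (ht : t.re ≤ 3 / 2) (k : ℕ) :
    ((k : ℝ) + 2) / 4 ≤ ‖2 * ((k : ℂ) + 1) - t‖ := by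
  have h := Complex.re_le_norm (2 * ((k : ℂ) + 1) - t)
  simp at h
  have : (0 : ℝ) ≤ k := by positivity
  linarith

/-! ### Convergence and holomorphy of both hypergeometric series. -/

section family

variable {A : ℂ → ℂ} {α X : ℝ}

/-- With `b = 1 - 2t/3`, the real part of `b - A t` is `1/2 - (2/3 - α) Re t`, so `X` is the
abscissa at which it vanishes. Staying `δ` to its left bounds `Re b` and `Re (b - A t)` below; the
two entries of the `min` are these bounds. -/
lemma exists_summable_bound_hyp3F2Term (hA : ∀ t, A t = 1 / 2 - α * t) (hα : |α| ≤ 1)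
    (hX : (2 / 3 - α) * X = 1 / 2) (hX0 : 0 < X) (hX1 : X ≤ 3 / 2) {δ R : ℝ} (hδ : 0 < δ)
    (hR : 0 ≤ R) :
    ∃ w : ℕ → ℝ, Summable w ∧ ∀ t : ℂ, ‖t‖ ≤ R → t.re ≤ X - δ → ∀ k : ℕ,
      ‖hyp3F2Term (-t / 2) (A t) 1 (1 - t / 2) (1 - 2 * t / 3) 1 k‖ ≤ w k := by
  have hα' : 0 < 2 / 3 - α := by
    by_contra! h
    nlinarith
  obtain ⟨w, hw, h⟩ := exists_summable_bound_pochRatio (1 + R) (min (2 * δ / 3) ((2 / 3 - α) * δ))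
    (by linarith) (lt_min (by positivity) (by positivity))
  -- `4 * R` covers the factor `t / (2k - t)` for `k ≥ 1`; the extra `1` covers the term `k = 0`,
  -- which equals `1`.
  refine ⟨fun k => (4 * R + 1) * w k, hw.mul_left _, fun t htR ht k => ?_⟩
  have hAt : ‖A t‖ ≤ 1 + R := by
    rw [hA]
    refine (norm_sub_le _ _).trans ?_
    rw [norm_mul, Complex.norm_real, Real.norm_eq_abs]
    have : |α| * ‖t‖ ≤ 1 * R := mul_le_mul hα htR (norm_nonneg _) zero_le_one
    norm_num
    linarith
  have hBt : ‖1 - 2 * t / 3‖ ≤ 1 + R := by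
    refine (norm_sub_le _ _).trans ?_
    norm_num
    linarith
  have h1 : min (2 * δ / 3) ((2 / 3 - α) * δ) ≤ (1 - 2 * t / 3).re := by
    refine (min_le_left _ _).trans ?_
    simp
    linarith
  have h2 : min (2 * δ / 3) ((2 / 3 - α) * δ) ≤ (1 - 2 * t / 3 - A t).re := by
    refine (min_le_right _ _).trans ?_
    rw [hA]
    simp
    nlinarith
  have h3 := h (A t) (1 - 2 * t / 3) hAt hBt h1 h2
  have hw0 : 0 ≤ w k := le_trans (by positivity) (h3 k)
  cases k with
  | zero =>
    have := h3 0
    simp [pochRatio_zero] at this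
    rw [hyp3F2Term_zero, norm_one]
    nlinarith
  | succ k =>
    rw [hyp3F2Term_succ t _ _ (by linarith), norm_mul, norm_neg, norm_div]
    have h4 := half_add_one_le_norm_sub (t := t) (by linarith) k
    have hk : (0 : ℝ) < ((k : ℝ) + 2) / 4 := by positivity
    have h5 : ‖t‖ / ‖2 * ((k : ℂ) + 1) - t‖ ≤ R / (((k : ℝ) + 2) / 4) :=
      div_le_div₀ hR htR hk h4
    have h6 := h3 (k + 1)
    push_cast at h6
    calc _ ≤ R / (((k : ℝ) + 2) / 4) * ‖pochRatio (A t) (1 - 2 * t / 3) (k + 1)‖ := by gcongr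
      _ = 4 * R * (‖pochRatio (A t) (1 - 2 * t / 3) (k + 1)‖ / ((k : ℝ) + 1 + 1)) := by
          field_simp; ring
      _ ≤ 4 * R * w (k + 1) := by gcongr
      _ ≤ _ := by nlinarith

lemma summable_hyp3F2Term (hA : ∀ t, A t = 1 / 2 - α * t) (hα : |α| ≤ 1)
    (hX : (2 / 3 - α) * X = 1 / 2) (hX0 : 0 < X) (hX1 : X ≤ 3 / 2) {t : ℂ} (ht : t.re < X) :
    Summable (hyp3F2Term (-t / 2) (A t) 1 (1 - t / 2) (1 - 2 * t / 3) 1) := by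
  obtain ⟨w, hw, h⟩ := exists_summable_bound_hyp3F2Term hA hα hX hX0 hX1
    (sub_pos.2 ht) (norm_nonneg t)
  exact Summable.of_norm_bounded hw (h t le_rfl (by linarith))

lemma differentiableOn_pochRatio (hA : ∀ t, A t = 1 / 2 - α * t) (k : ℕ) :
    DifferentiableOn ℂ (fun t => pochRatio (A t) (1 - 2 * t / 3) k) {t : ℂ | t.re < 3 / 2} := by
  have : A = fun t : ℂ => 1 / 2 - (α : ℂ) * t := funext hA
  subst this
  unfold pochRatio
  refine DifferentiableOn.fun_finsetProd fun j _ => ?_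
  refine DifferentiableOn.div (by fun_prop) (by fun_prop) fun t ht h0 => ?_
  have := congrArg Complex.re h0
  simp at this ht
  have : (0 : ℝ) ≤ j := by positivity
  linarith

lemma differentiableOn_hyp3F2 (hA : ∀ t, A t = 1 / 2 - α * t) (hα : |α| ≤ 1)
    (hX : (2 / 3 - α) * X = 1 / 2) (hX0 : 0 < X) (hX1 : X ≤ 3 / 2) :
    DifferentiableOn ℂ (fun t : ℂ => hyp3F2 (-t / 2) (A t) 1 (1 - t / 2) (1 - 2 * t / 3) 1)
      {t : ℂ | t.re < X} := by
  intro t₀ ht₀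
  have ht₀' : t₀.re < X := ht₀
  -- Half the distance to the boundary line leaves a neighbourhood of `t₀` on which the Weierstrass
  -- test applies.
  set δ := (X - t₀.re) / 2 with hδ
  have hδ0 : 0 < δ := by rw [hδ]; linarith
  obtain ⟨w, hw, h⟩ := exists_summable_bound_hyp3F2Term hA hα hX hX0 hX1 hδ0
    (R := ‖t₀‖ + 1) (by positivity)
  set U : Set ℂ := Metric.ball 0 (‖t₀‖ + 1) ∩ {t : ℂ | t.re < X - δ} with hU
  have hUo : IsOpen U := Metric.isOpen_ball.inter (isOpen_lt Complex.continuous_re continuous_const)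
  have hmem : t₀ ∈ U := ⟨by simp, by simp only [Set.mem_ofPred_eq]; linarith⟩
  have hlt : ∀ t ∈ U, t.re < 3 / 2 := fun t ht => by
    have : t.re < X - δ := ht.2
    linarith
  have hterm : ∀ k, DifferentiableOn ℂ
      (fun t => hyp3F2Term (-t / 2) (A t) 1 (1 - t / 2) (1 - 2 * t / 3) 1 k) U := by
    intro k
    cases k with
    | zero => simp only [hyp3F2Term_zero]; exact differentiableOn_const _
    | succ k =>
      refine DifferentiableOn.congr (f := fun t => -(t / (2 * ((k : ℂ) + 1) - t)) *
        pochRatio (A t) (1 - 2 * t / 3) (k + 1)) ?_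
        fun t ht => hyp3F2Term_succ t _ _ ((hlt t ht).trans (by norm_num)) k
      refine DifferentiableOn.mul (DifferentiableOn.neg (DifferentiableOn.div (by fun_prop)
        (by fun_prop) fun t ht h0 => ?_)) ((differentiableOn_pochRatio hA _).mono hlt)
      have h4 := half_add_one_le_norm_sub (hlt t ht).le k
      rw [h0, norm_zero] at h4
      have : (0 : ℝ) ≤ k := by positivity
      linarith
  have hd := Complex.differentiableOn_tsum_of_summable_norm hw hterm hUo fun k t ht =>
    h t (by simpa using (mem_ball_zero_iff.1 ht.1).le) (le_of_lt ht.2) k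
  exact (hd.differentiableAt (hUo.mem_nhds hmem)).differentiableWithinAt

end family

/-! ### Real parameters, telescoping sums and homogeneous shift equations. -/

lemma tendsto_pochRatio_zero_real {a b : ℝ} (hb : 0 < b) (hab : a < b) :
    Tendsto (pochRatio a b) atTop (𝓝 0) := by
  have h := tendsto_pochRatio_zero (a := (a : ℂ)) (b := (b : ℂ)) (by simpa) (by simpa)
  have h1 := (Complex.continuous_re.tendsto 0).comp h
  simpa [Function.comp_def, ← ofReal_pochRatio] using h1

lemma pochRatio_nonneg {a b : ℝ} (ha : 0 ≤ a) (hb : 0 ≤ b) (k : ℕ) : 0 ≤ pochRatio a b k :=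
  prod_nonneg fun _ _ => by positivity

lemma summable_pochRatio_div {a b u : ℝ} (hb : 0 < b) (hab : a < b) (hu : 0 < u) :
    Summable fun k : ℕ => pochRatio a b k / (2 * k + u) := by
  obtain ⟨w, hw, h⟩ := exists_summable_bound_pochRatio (max 1 (max ‖(a : ℂ)‖ ‖(b : ℂ)‖))
    (min b (b - a)) (le_max_left _ _) (lt_min hb (sub_pos.2 hab))
  refine Summable.of_norm_bounded (hw.mul_left (1 / min 1 u)) fun k => ?_
  have h1 := h a b ((le_max_left _ _).trans (le_max_right _ _))
    ((le_max_right _ _).trans (le_max_right _ _)) (by simp) (by simp) k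
  rw [← ofReal_pochRatio, Complex.norm_real] at h1
  have hm : 0 < min 1 u := lt_min one_pos hu
  have hk : (0 : ℝ) ≤ k := by positivity
  have h2 : min 1 u * ((k : ℝ) + 1) ≤ 2 * k + u := by
    have := min_le_left 1 u
    have := min_le_right 1 u
    nlinarith
  rw [norm_div, Real.norm_of_nonneg (by positivity : 0 ≤ 2 * (k : ℝ) + u)]
  calc ‖pochRatio a b k‖ / (2 * k + u) ≤ ‖pochRatio a b k‖ / (min 1 u * ((k : ℝ) + 1)) := by
        gcongr
    _ = 1 / min 1 u * (‖pochRatio a b k‖ / ((k : ℝ) + 1)) := by field_simp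
    _ ≤ _ := by gcongr

/-- Summation of a recurrence whose inhomogeneous part telescopes. -/
lemma tsum_eq_of_telescope {r r' G : ℕ → ℝ} {c : ℝ} (hr : Summable r) (hr' : Summable r')
    (hG : Tendsto G atTop (𝓝 0)) (h : ∀ j, r (j + 3) - c * r' j = G (j + 1) - G j) :
    ∑' k, r k = r 0 + r 1 + r 2 - G 0 + c * ∑' k, r' k := by
  have h3 : Summable fun j => r (j + 3) := (summable_nat_add_iff 3).2 hr
  have h4 : HasSum (fun j => r (j + 3) - c * r' j) (∑' j, r (j + 3) - c * ∑' j, r' j) :=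
    h3.hasSum.sub (hr'.hasSum.mul_left c)
  have h5 := h4.tendsto_sum_nat
  simp only [h, sum_range_sub] at h5
  have h6 := tendsto_nhds_unique h5 (hG.sub_const (G 0))
  have h7 := hr.sum_add_tsum_nat_add 3
  simp [sum_range_succ] at h7
  linarith

/-- Iteration gives `f v = c ^ n * f (v + n)`, and the right side tends to `0`. -/
lemma eq_zero_of_shift {f : ℝ → ℝ} {c v B : ℝ} (hc : |c| < 1) (hv : 0 < v)
    (hf : ∀ x, 0 < x → f x = c * f (x + 1)) (hB : ∀ n : ℕ, |f (v + n)| ≤ B) : f v = 0 := by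
  have h : ∀ n : ℕ, f v = c ^ n * f (v + n) := fun n => by
    induction n with
    | zero => simp
    | succ n ih =>
      rw [ih, hf (v + n) (by positivity)]
      push_cast
      rw [pow_succ, add_assoc]; ring
  have h1 : Tendsto (fun n : ℕ => |c| ^ n * B) atTop (𝓝 0) := by
    simpa using (tendsto_pow_atTop_nhds_zero_of_lt_one (abs_nonneg c) hc).mul_const B
  have h2 : |f v| ≤ 0 := ge_of_tendsto' h1 fun n => by
    rw [h n, abs_mul, abs_pow]
    exact mul_le_mul_of_nonneg_left (hB n) (by positivity)
  exact abs_nonpos_iff.1 h2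

/-! ### Lerch sums: bounds and shift recurrences. -/

/-- The series `∑ w_k / (k + v)`. -/
def lerchSum (w : ℕ → ℝ) (v : ℝ) : ℝ := ∑' k : ℕ, w k / (k + v)

section lerch

variable {w : ℕ → ℝ} {ρ v : ℝ}

lemma norm_lerchTerm_le (hw : ∀ k, |w k| ≤ ρ ^ k) (hv : 0 < v) (k : ℕ) :
    ‖w k / (k + v)‖ ≤ ρ ^ k * v⁻¹ := by
  have hk : v ≤ (k : ℝ) + v := by simp
  rw [norm_div, Real.norm_of_nonneg (hv.le.trans hk), Real.norm_eq_abs, ← div_eq_mul_inv]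
  exact div_le_div₀ ((abs_nonneg _).trans (hw k)) (hw k) hv hk

lemma summable_lerchTerm (hw : ∀ k, |w k| ≤ ρ ^ k) (hρ : 0 ≤ ρ) (hρ1 : ρ < 1) (hv : 0 < v) :
    Summable fun k : ℕ => w k / (k + v) :=
  Summable.of_norm_bounded ((summable_geometric_of_lt_one hρ hρ1).mul_right _)
    (norm_lerchTerm_le hw hv)

lemma abs_lerchSum_le (hw : ∀ k, |w k| ≤ ρ ^ k) (hρ : 0 ≤ ρ) (hρ1 : ρ < 1) (hv : 0 < v) :
    |lerchSum w v| ≤ (1 - ρ)⁻¹ * v⁻¹ :=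
  tsum_of_norm_bounded ((hasSum_geometric_of_lt_one hρ hρ1).mul_right _)
    (norm_lerchTerm_le hw hv)

/-- Splitting off `N` terms shifts the denominators by `N`; quasi-periodicity of the weights turns
the tail into a multiple of the same sum. -/
lemma lerchSum_shift (hw : ∀ k, |w k| ≤ ρ ^ k) (hρ : 0 ≤ ρ) (hρ1 : ρ < 1) (hv : 0 < v)
    (N : ℕ) {c : ℝ} (hc : ∀ k, w (k + N) = c * w k) :
    lerchSum w v = ∑ k ∈ range N, w k / (k + v) + c * lerchSum w (v + N) := by
  rw [lerchSum, ← (summable_lerchTerm hw hρ hρ1 hv).sum_add_tsum_nat_add N, lerchSum,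
    ← tsum_mul_left]
  congr 2
  ext k
  rw [hc]
  push_cast
  rw [mul_div_assoc, add_comm v, add_assoc]

lemma abs_lerchSum_add_le (hw : ∀ k, |w k| ≤ ρ ^ k) (hρ : 0 ≤ ρ) (hρ1 : ρ < 1) (hv : 0 < v)
    {x : ℝ} (hx : v ≤ x) : |lerchSum w x| ≤ (1 - ρ)⁻¹ * v⁻¹ := by
  refine (abs_lerchSum_le hw hρ hρ1 (hv.trans_le hx)).trans ?_
  have : 0 ≤ (1 - ρ)⁻¹ := inv_nonneg.2 (by linarith)
  gcongr

end lerch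

lemma abs_pow_le_of_abs_eq {q ρ : ℝ} (h : |q| = ρ) (k : ℕ) : |q ^ k| ≤ ρ ^ k := by
  rw [abs_pow, h]

/-- A sequence of sums that decreases under the shift stays bounded by its first value. -/
lemma abs_tsum_add_natCast_le {r : ℝ → ℕ → ℝ} {v : ℝ} (hv : 0 < v)
    (hr : ∀ x, 0 < x → Summable (r x)) (h0 : ∀ x, 0 < x → ∀ k, 0 ≤ r x k)
    (hle : ∀ x, 0 < x → ∀ k, r (x + 1) k ≤ r x k) (n : ℕ) :
    |∑' k, r (v + n) k| ≤ ∑' k, r v k := by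
  rw [abs_of_nonneg (tsum_nonneg (h0 _ (by positivity)))]
  refine Summable.tsum_le_tsum (fun k => ?_) (hr _ (by positivity)) (hr v hv)
  induction n with
  | zero => simp
  | succ n ih =>
    refine le_trans ?_ ih
    push_cast
    rw [← add_assoc]
    exact hle _ (by positivity) k

/-! ### Creative telescoping for the two hypergeometric sums. -/

lemma pochRatio_shift_one {a b : ℝ} (ha : 0 < a) (hb : 0 < b) (j : ℕ) :
    pochRatio (a + 1) (b + 4) j = pochRatio a b (j + 3) * (b * (b + 1) * (b + 2) * (b + 3)) /
      (a * (a + j + 1) * (a + j + 2) * (b + j + 3)) := by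
  induction j with
  | zero =>
    simp [pochRatio, prod_range_succ]
    field_simp
  | succ j ih =>
    rw [pochRatio_succ, ih, show j + 1 + 3 = (j + 3) + 1 by ring, pochRatio_succ a b (j + 3)]
    push_cast
    field_simp
    ring

lemma pochRatio_shift_two {a b : ℝ} (ha : 0 < a) (hb : 0 < b) (j : ℕ) :
    pochRatio (a + 2) (b + 4) j = pochRatio a b (j + 3) * (b * (b + 1) * (b + 2) * (b + 3)) /
      (a * (a + 1) * (a + j + 2) * (b + j + 3)) := by
  induction j with
  | zero =>
    simp [pochRatio, prod_range_succ]
    field_simp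
  | succ j ih =>
    rw [pochRatio_succ, ih, show j + 1 + 3 = (j + 3) + 1 by ring, pochRatio_succ a b (j + 3)]
    push_cast
    field_simp
    ring

/-- Factor by factor the claim is `d (b + j) ≤ 4 (a + j)`. It serves `d = 1` and `d = 2`; in the
latter case `d * b = 4 * a` holds exactly. -/
lemma pochRatio_shift_le {a b d : ℝ} (ha : 0 < a) (hb : 0 < b) (hd : 0 ≤ d) (hd4 : d ≤ 4)
    (h : d * b ≤ 4 * a) (k : ℕ) : pochRatio (a + d) (b + 4) k ≤ pochRatio a b k := by
  refine prod_le_prod (fun j _ => by positivity) fun j _ => ?_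
  rw [div_le_div_iff₀ (by positivity) (by positivity)]
  have : (0 : ℝ) ≤ j := by positivity
  nlinarith

lemma tendsto_pochRatio_mul_zero {a b K : ℝ} (hb : 0 < b) (hab : a < b) {h : ℕ → ℝ}
    (hK : ∀ j, |h j| ≤ K) : Tendsto (fun j => pochRatio a b (j + 3) * h j) atTop (𝓝 0) := by
  have h1 := (tendsto_pochRatio_zero_real hb hab).comp (tendsto_add_atTop_nat 3)
  have h2 : Tendsto (fun j => |pochRatio a b (j + 3)| * K) atTop (𝓝 0) := by
    simpa using h1.abs.mul_const K
  refine squeeze_zero_norm (fun j => ?_) h2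
  rw [norm_mul, Real.norm_eq_abs, Real.norm_eq_abs]
  exact mul_le_mul_of_nonneg_left (hK j) (abs_nonneg _)

/-- The summand of the first series, at the parameter `t = -6 v`. -/
def termC (v : ℝ) (k : ℕ) : ℝ := pochRatio (1 / 2 + v) (1 + 4 * v) k / (2 * k + 6 * v)

/-- The rational certificate for the shift `v ↦ v + 1` of `termC`. -/
def certC (v y : ℝ) : ℝ :=
  -(1 / (6 * v + 1)) * y ^ 2 + (18 * v ^ 2 + 17 * v + 5) / ((6 * v + 1) * (6 * v + 3)) * y
    - (20 * v ^ 2 + 20 * v + 9) / (4 * (6 * v + 5) * (6 * v + 1) * (6 * v + 3))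

/-- The summand of the second series, at the parameter `t = -6 v`. -/
def termD (v : ℝ) (k : ℕ) : ℝ := pochRatio (1 / 2 + 2 * v) (1 + 4 * v) k / (2 * k + 6 * v)

/-- The rational certificate for the shift `v ↦ v + 1` of `termD`. -/
def certD (v y : ℝ) : ℝ := -(1 / (4 * v + 1)) * y + 1 / (2 * (4 * v + 3) * (4 * v + 1))

/-- The argument `y` of the certificate is `k + 3v` at `k = j + 3`, half of the denominator common
to the two terms on the left. Dividing by the common Pochhammer quotient leaves an identity of
rational functions. -/
lemma termC_telescope {v : ℝ} (hv : 0 < v) (j : ℕ) :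
    termC v (j + 3) - 1 / 64 * termC (v + 1) j =
      pochRatio (1 / 2 + v) (1 + 4 * v) (j + 1 + 3) *
        (certC v ((j + 1 : ℕ) + 3 + 3 * v) /
          ((1 / 2 + v + (j + 1 : ℕ) + 1) * (1 / 2 + v + (j + 1 : ℕ) + 2))) -
      pochRatio (1 / 2 + v) (1 + 4 * v) (j + 3) *
        (certC v (j + 3 + 3 * v) / ((1 / 2 + v + j + 1) * (1 / 2 + v + j + 2))) := by
  have h := pochRatio_shift_one (a := 1 / 2 + v) (b := 1 + 4 * v) (by positivity) (by positivity) j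
  rw [termC, termC, show 1 / 2 + (v + 1) = 1 / 2 + v + 1 by ring,
    show 1 + 4 * (v + 1) = 1 + 4 * v + 4 by ring, h, show j + 1 + 3 = (j + 3) + 1 by ring,
    pochRatio_succ _ _ (j + 3), certC, certC]
  push_cast
  field_simp
  ring

lemma termD_telescope {v : ℝ} (hv : 0 < v) (j : ℕ) :
    termD v (j + 3) - -(1 / 64) * termD (v + 1) j =
      pochRatio (1 / 2 + 2 * v) (1 + 4 * v) (j + 1 + 3) *
        (certD v ((j + 1 : ℕ) + 3 + 3 * v) / (1 / 2 + 2 * v + (j + 1 : ℕ) + 2)) -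
      pochRatio (1 / 2 + 2 * v) (1 + 4 * v) (j + 3) *
        (certD v (j + 3 + 3 * v) / (1 / 2 + 2 * v + j + 2)) := by
  have h := pochRatio_shift_two (a := 1 / 2 + 2 * v) (b := 1 + 4 * v) (by positivity)
    (by positivity) j
  rw [termD, termD, show 1 / 2 + 2 * (v + 1) = 1 / 2 + 2 * v + 2 by ring,
    show 1 + 4 * (v + 1) = 1 + 4 * v + 4 by ring, h, show j + 1 + 3 = (j + 3) + 1 by ring,
    pochRatio_succ _ _ (j + 3), certD, certD]
  push_cast
  field_simp
  ring

/-- Numerator and denominator both have degree `2` in `j`. Boundedness suffices, since the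
accompanying Pochhammer quotient tends to `0`. -/
lemma abs_certC_div_le {v : ℝ} (hv : 0 < v) : ∃ K, ∀ j : ℕ,
    |certC v (j + 3 + 3 * v) / ((1 / 2 + v + j + 1) * (1 / 2 + v + j + 2))| ≤ K := by
  set A := 1 / (6 * v + 1)
  set B := (18 * v ^ 2 + 17 * v + 5) / ((6 * v + 1) * (6 * v + 3))
  set C := (20 * v ^ 2 + 20 * v + 9) / (4 * (6 * v + 5) * (6 * v + 1) * (6 * v + 3))
  have hA : 0 ≤ A := by positivity
  have hB : 0 ≤ B := by positivity
  have hC : 0 ≤ C := by positivity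
  refine ⟨(A + B + C) * (3 + 3 * v) ^ 2, fun j => ?_⟩
  have hj : (0 : ℝ) ≤ j := by positivity
  set y := (j : ℝ) + 3 + 3 * v with hy
  have hy1 : 1 ≤ y := by linarith
  have h1 : |certC v y| ≤ (A + B + C) * y ^ 2 := by
    have e : certC v y = -A * y ^ 2 + B * y - C := rfl
    rw [e, abs_le]
    have : y ≤ y ^ 2 := by nlinarith
    have : 1 ≤ y ^ 2 := by nlinarith
    constructor <;> nlinarith [mul_nonneg hA (sq_nonneg y)]
  have h2 : y ≤ (3 + 3 * v) * (j + 1) := by nlinarith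
  have h3 : ((j : ℝ) + 1) ^ 2 ≤ (1 / 2 + v + j + 1) * (1 / 2 + v + j + 2) := by nlinarith
  rw [abs_div, abs_of_pos (by positivity : 0 < (1 / 2 + v + (j : ℝ) + 1) * (1 / 2 + v + j + 2)),
    div_le_iff₀ (by positivity)]
  calc |certC v y| ≤ (A + B + C) * y ^ 2 := h1
    _ ≤ (A + B + C) * ((3 + 3 * v) * (j + 1)) ^ 2 := by gcongr
    _ = (A + B + C) * (3 + 3 * v) ^ 2 * ((j : ℝ) + 1) ^ 2 := by ring
    _ ≤ _ := by gcongr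

lemma abs_certD_div_le {v : ℝ} (hv : 0 < v) : ∃ K, ∀ j : ℕ,
    |certD v (j + 3 + 3 * v) / (1 / 2 + 2 * v + j + 2)| ≤ K := by
  set A := 1 / (4 * v + 1)
  set C := 1 / (2 * (4 * v + 3) * (4 * v + 1))
  have hA : 0 ≤ A := by positivity
  have hC : 0 ≤ C := by positivity
  refine ⟨(A + C) * (3 + 3 * v), fun j => ?_⟩
  have hj : (0 : ℝ) ≤ j := by positivity
  set y := (j : ℝ) + 3 + 3 * v with hy
  have hy1 : 1 ≤ y := by linarith
  have h1 : |certD v y| ≤ (A + C) * y := by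
    have e : certD v y = -A * y + C := rfl
    rw [e, abs_le]
    constructor <;> nlinarith [mul_nonneg hA (zero_le_one.trans hy1)]
  have h2 : y ≤ (3 + 3 * v) * (j + 1) := by nlinarith
  rw [abs_div, abs_of_pos (by positivity : 0 < 1 / 2 + 2 * v + (j : ℝ) + 2),
    div_le_iff₀ (by positivity)]
  calc |certD v y| ≤ (A + C) * y := h1
    _ ≤ (A + C) * ((3 + 3 * v) * (j + 1)) := by gcongr
    _ = (A + C) * (3 + 3 * v) * ((j : ℝ) + 1) := by ring
    _ ≤ _ := mul_le_mul_of_nonneg_left (by linarith) (by positivity)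

lemma summable_termC {v : ℝ} (hv : 0 < v) : Summable (termC v) :=
  summable_pochRatio_div (by positivity) (by linarith) (by positivity)

lemma summable_termD {v : ℝ} (hv : 0 < v) : Summable (termD v) :=
  summable_pochRatio_div (by positivity) (by linarith) (by positivity)

lemma tsum_termC_shift {v : ℝ} (hv : 0 < v) :
    ∑' k, termC v k = ∑ k ∈ range 2, (-1 / 8 : ℝ) ^ k / (k + 2 * v)
      - 2 * ∑ k ∈ range 6, (-1 / 2 : ℝ) ^ k / (k + 6 * v) + 1 / 64 * ∑' k, termC (v + 1) k := by
  obtain ⟨K, hK⟩ := abs_certC_div_le hv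
  have hG := tendsto_pochRatio_mul_zero (a := 1 / 2 + v) (b := 1 + 4 * v) (by positivity)
    (by linarith) hK
  rw [tsum_eq_of_telescope (summable_termC hv) (summable_termC (by positivity)) hG
    (termC_telescope hv)]
  -- What remains is rational in `v`: the three initial terms minus the boundary value of the
  -- certificate against the finite Lerch pieces.
  congr 1
  simp only [termC, certC, pochRatio, sum_range_succ, prod_range_succ, prod_range_zero,
    sum_range_zero]
  push_cast
  field_simp
  ring

/-- The real parts of the powers of `(1 + i) / 4`. -/
def rePow (k : ℕ) : ℝ := (((1 + Complex.I) / 4) ^ k).re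

lemma rePow_add_four (k : ℕ) : rePow (k + 4) = -(1 / 64) * rePow k := by
  have h : ((1 + Complex.I) / 4) ^ 4 = ((-(1 / 64) : ℝ) : ℂ) := by
    have h2 : (1 + Complex.I) ^ 2 = 2 * Complex.I := by
      linear_combination Complex.I_sq
    rw [div_pow, show 4 = 2 * 2 from rfl, pow_mul, h2]
    push_cast
    linear_combination (1 / 64 : ℂ) * Complex.I_sq
  rw [rePow, rePow, pow_add, h, mul_comm, Complex.re_ofReal_mul]

lemma norm_one_add_I_div_four : ‖(1 + Complex.I) / 4‖ ≤ 1 / 2 := by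
  rw [norm_div]
  have : ‖1 + Complex.I‖ ≤ 2 := (norm_add_le _ _).trans (by norm_num)
  norm_num
  linarith

lemma abs_rePow_le (k : ℕ) : |rePow k| ≤ (1 / 2) ^ k :=
  (Complex.abs_re_le_norm _).trans
    (by rw [norm_pow]; exact pow_le_pow_left₀ (norm_nonneg _) norm_one_add_I_div_four k)

lemma sum_rePow_div (x : ℝ) : ∑ k ∈ range 4, rePow k / (k + x) =
    1 / x + 1 / 4 / (1 + x) - 1 / 32 / (3 + x) := by
  have h0 : rePow 0 = 1 := by simp [rePow]
  have h1 : rePow 1 = 1 / 4 := by simp [rePow]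
  have h2 : rePow 2 = 0 := by simp [rePow, pow_succ]
  have h3 : rePow 3 = -(1 / 32) := by simp [rePow, pow_succ]; norm_num
  simp only [sum_range_succ, sum_range_zero, h0, h1, h2, h3]
  push_cast
  ring

lemma tsum_termD_shift {v : ℝ} (hv : 0 < v) :
    ∑' k, termD v k = 2 * ∑ k ∈ range 4, rePow k / (k + 4 * v)
      - ∑ k ∈ range 3, (-1 / 4 : ℝ) ^ k / (k + 3 * v) + -(1 / 64) * ∑' k, termD (v + 1) k := by
  obtain ⟨K, hK⟩ := abs_certD_div_le hv
  have hG := tendsto_pochRatio_mul_zero (a := 1 / 2 + 2 * v) (b := 1 + 4 * v) (by positivity)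
    (by linarith) hK
  rw [tsum_eq_of_telescope (summable_termD hv) (summable_termD (by positivity)) hG
    (termD_telescope hv), sum_rePow_div]
  congr 1
  simp only [termD, certD, pochRatio, sum_range_succ, prod_range_succ, prod_range_zero,
    sum_range_zero]
  push_cast
  field_simp
  ring

/-! ### Evaluation of the hypergeometric sums by Lerch sums. -/

theorem tsum_termC {v : ℝ} (hv : 0 < v) :
    ∑' k, termC v k = lerchSum (fun k => (-1 / 8) ^ k) (2 * v)
      - 2 * lerchSum (fun k => (-1 / 2) ^ k) (6 * v) := by
  have hw8 := abs_pow_le_of_abs_eq (q := -1 / 8) (ρ := 1 / 8) (by norm_num [abs_div])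
  have hw2 := abs_pow_le_of_abs_eq (q := -1 / 2) (ρ := 1 / 2) (by norm_num [abs_div])
  set f : ℝ → ℝ := fun v => ∑' k, termC v k - (lerchSum (fun k => (-1 / 8) ^ k) (2 * v)
      - 2 * lerchSum (fun k => (-1 / 2) ^ k) (6 * v)) with hf
  suffices f v = 0 from sub_eq_zero.1 this
  -- The bound `B` adds the values at `v` of bounds for the three sums, none of which grows under `v
  -- ↦ v + n`.
  refine eq_zero_of_shift (c := 1 / 64) (B := ∑' k, termC v k +
    ((1 - 1 / 8)⁻¹ * (2 * v)⁻¹ + 2 * ((1 - 1 / 2)⁻¹ * (6 * v)⁻¹)))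
    (by norm_num [abs_div]) hv (fun x hx => ?_) fun n => ?_
  · have h1 := lerchSum_shift hw8 (by norm_num) (by norm_num) (by positivity : 0 < 2 * x) 2
      (c := 1 / 64) fun k => by ring
    have h2 := lerchSum_shift hw2 (by norm_num) (by norm_num) (by positivity : 0 < 6 * x) 6
      (c := 1 / 64) fun k => by ring
    have h3 := tsum_termC_shift hx
    simp only [hf]
    push_cast at h1 h2
    rw [mul_add, mul_add, mul_one, mul_one, h1, h2, h3]
    ring
  · have h1 := abs_lerchSum_add_le hw8 (by norm_num) (by norm_num) (by positivity : 0 < 2 * v)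
      (x := 2 * (v + n)) (by gcongr; simp)
    have h2 := abs_lerchSum_add_le hw2 (by norm_num) (by norm_num) (by positivity : 0 < 6 * v)
      (x := 6 * (v + n)) (by gcongr; simp)
    have h3 := abs_tsum_add_natCast_le hv (r := termC) (fun x hx => summable_termC hx)
      (fun x hx k => div_nonneg (pochRatio_nonneg (by positivity) (by positivity) k)
        (by positivity)) (fun x hx k => ?_) n
    · refine (abs_sub _ _).trans (add_le_add h3 ((abs_sub _ _).trans (add_le_add h1 ?_)))
      rw [abs_mul, abs_two]
      gcongr
    · have := pochRatio_shift_le (a := 1 / 2 + x) (b := 1 + 4 * x) (d := 1) (by positivity)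
        (by positivity) (by norm_num) (by norm_num) (by linarith) k
      rw [termC, termC, show 1 / 2 + (x + 1) = 1 / 2 + x + 1 by ring,
        show 1 + 4 * (x + 1) = 1 + 4 * x + 4 by ring]
      exact div_le_div₀ (pochRatio_nonneg (by positivity) (by positivity) k) this
        (by positivity) (by linarith)

theorem tsum_termD {v : ℝ} (hv : 0 < v) :
    ∑' k, termD v k = 2 * lerchSum rePow (4 * v)
      - lerchSum (fun k => (-1 / 4) ^ k) (3 * v) := by
  have hw4 := abs_pow_le_of_abs_eq (q := -1 / 4) (ρ := 1 / 4) (by norm_num [abs_div])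
  set f : ℝ → ℝ := fun v => ∑' k, termD v k - (2 * lerchSum rePow (4 * v)
      - lerchSum (fun k => (-1 / 4) ^ k) (3 * v)) with hf
  suffices f v = 0 from sub_eq_zero.1 this
  refine eq_zero_of_shift (c := -(1 / 64)) (B := ∑' k, termD v k +
    (2 * ((1 - 1 / 2)⁻¹ * (4 * v)⁻¹) + (1 - 1 / 4)⁻¹ * (3 * v)⁻¹))
    (by norm_num [abs_div]) hv (fun x hx => ?_) fun n => ?_
  · have h1 := lerchSum_shift abs_rePow_le (by norm_num) (by norm_num)
      (by positivity : 0 < 4 * x) 4 rePow_add_four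
    have h2 := lerchSum_shift hw4 (by norm_num) (by norm_num) (by positivity : 0 < 3 * x) 3
      (c := -(1 / 64)) fun k => by ring
    have h3 := tsum_termD_shift hx
    simp only [hf]
    push_cast at h1 h2
    rw [mul_add, mul_add, mul_one, mul_one, h1, h2, h3]
    ring
  · have h1 := abs_lerchSum_add_le abs_rePow_le (by norm_num) (by norm_num)
      (by positivity : 0 < 4 * v) (x := 4 * (v + n)) (by gcongr; simp)
    have h2 := abs_lerchSum_add_le hw4 (by norm_num) (by norm_num) (by positivity : 0 < 3 * v)
      (x := 3 * (v + n)) (by gcongr; simp)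
    have h3 := abs_tsum_add_natCast_le hv (r := termD) (fun x hx => summable_termD hx)
      (fun x hx k => div_nonneg (pochRatio_nonneg (by positivity) (by positivity) k)
        (by positivity)) (fun x hx k => ?_) n
    · refine (abs_sub _ _).trans (add_le_add h3 ((abs_sub _ _).trans (add_le_add ?_ h2)))
      rw [abs_mul, abs_two]
      gcongr
    · have := pochRatio_shift_le (a := 1 / 2 + 2 * x) (b := 1 + 4 * x) (d := 2) (by positivity)
        (by positivity) (by norm_num) (by norm_num) (by linarith) k
      rw [termD, termD, show 1 / 2 + 2 * (x + 1) = 1 / 2 + 2 * x + 2 by ring,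
        show 1 + 4 * (x + 1) = 1 + 4 * x + 4 by ring]
      exact div_le_div₀ (pochRatio_nonneg (by positivity) (by positivity) k) this
        (by positivity) (by linarith)

/-! ### Generating functions of polylogarithmic values. -/

/-- The series `∑_{k ≥ 1} c_k / k ^ n`. -/
def dirSum (c : ℕ → ℝ) (n : ℕ) : ℝ := ∑' k : ℕ, c (k + 1) / ((k : ℝ) + 1) ^ n

/-- The series `∑_{k ≥ 1} c_k τ / (k - τ)`. -/
def genSum (c : ℕ → ℝ) (τ : ℂ) : ℂ := ∑' k : ℕ, (c (k + 1) : ℂ) * (τ / ((k : ℂ) + 1 - τ))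

lemma norm_div_natCast_add_one_le (τ : ℂ) (k : ℕ) : ‖τ / ((k : ℂ) + 1)‖ ≤ ‖τ‖ := by
  have h : ‖(k : ℂ) + 1‖ = (k : ℝ) + 1 := by
    exact_mod_cast Complex.norm_natCast (k + 1)
  rw [norm_div, h]
  exact div_le_self (norm_nonneg _) (by simp)

lemma one_sub_norm_le (τ : ℂ) (k : ℕ) : 1 - ‖τ‖ ≤ ‖(k : ℂ) + 1 - τ‖ := by
  have h := Complex.re_le_norm ((k : ℂ) + 1 - τ)
  have h1 := Complex.re_le_norm τ
  simp at h
  have : (0 : ℝ) ≤ k := by positivity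
  linarith

section generating

variable {c : ℕ → ℝ} {ρ : ℝ}

/-- The generating function of the numbers `dirSum c n`. -/
lemma hasSum_dirSum_mul_pow (hc : ∀ k, |c k| ≤ ρ ^ k) (hρ : 0 ≤ ρ) (hρ1 : ρ < 1) {τ : ℂ}
    (hτ : ‖τ‖ < 1) :
    HasSum (fun n : ℕ => (dirSum c (n + 1) : ℂ) * τ ^ (n + 1)) (genSum c τ) := by
  -- The double series is dominated by a product of two geometric series; summing over `n` first is
  -- a geometric sum with ratio `τ / (k + 1)`.
  set F : ℕ → ℕ → ℂ := fun n k => (c (k + 1) : ℂ) * (τ / ((k : ℂ) + 1)) ^ (n + 1) with hF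
  have hgτ : Summable fun n : ℕ => ‖τ‖ ^ (n + 1) :=
    (summable_nat_add_iff 1).2 (summable_geometric_of_lt_one (norm_nonneg _) hτ)
  have hgρ : Summable fun k : ℕ => ρ ^ (k + 1) :=
    (summable_nat_add_iff 1).2 (summable_geometric_of_lt_one hρ hρ1)
  have hsum : Summable (Function.uncurry F) := by
    refine Summable.of_norm_bounded (hgτ.mul_of_nonneg hgρ (fun _ => by positivity)
      (fun _ => by positivity)) ?_
    rintro ⟨n, k⟩
    simp only [Function.uncurry, hF, norm_mul, norm_pow, Complex.norm_real, Real.norm_eq_abs]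
    rw [mul_comm]
    exact mul_le_mul (pow_le_pow_left₀ (norm_nonneg _) (norm_div_natCast_add_one_le τ k) _)
      (hc _) (abs_nonneg _) (by positivity)
  have hrow : ∀ n, ∑' k, F n k = (dirSum c (n + 1) : ℂ) * τ ^ (n + 1) := fun n => by
    rw [dirSum, Complex.ofReal_tsum, ← tsum_mul_right]
    congr 1
    ext k
    simp only [hF]
    push_cast
    rw [div_pow]
    ring
  have hcol : ∀ k, ∑' n, F n k = (c (k + 1) : ℂ) * (τ / ((k : ℂ) + 1 - τ)) := fun k => by
    simp only [hF]
    have hx : ‖τ / ((k : ℂ) + 1)‖ < 1 := (norm_div_natCast_add_one_le τ k).trans_lt hτ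
    have hk : (k : ℂ) + 1 ≠ 0 := by exact_mod_cast k.succ_ne_zero
    have hkτ : (k : ℂ) + 1 - τ ≠ 0 := fun h => by
      have := one_sub_norm_le τ k
      rw [h, norm_zero] at this
      linarith
    simp only [pow_succ]
    rw [tsum_mul_left, tsum_mul_right, tsum_geometric_of_norm_lt_one hx, one_sub_div hk]
    field_simp
  have h1 := hsum.hasSum.prod_fiberwise fun n => (hsum.prod_factor n).hasSum
  simp only [Function.uncurry] at h1
  have h2 : ∑' p, Function.uncurry F p = genSum c τ := by
    rw [hsum.tsum_prod]
    simp only [Function.uncurry]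
    rw [← hsum.tsum_comm]
    simp only [hcol]
    rfl
  rw [← h2]
  simpa only [hrow, Function.uncurry] using h1

lemma differentiableOn_genSum (hc : ∀ k, |c k| ≤ ρ ^ k) (hρ : 0 ≤ ρ) (hρ1 : ρ < 1) :
    DifferentiableOn ℂ (genSum c) (Metric.ball 0 1) := by
  intro τ₀ hτ₀
  obtain ⟨r, hr, hr1⟩ := exists_between (mem_ball_zero_iff.1 hτ₀)
  have hr0 : 0 < 1 - r := by linarith
  have hgρ : Summable fun k : ℕ => ρ ^ (k + 1) :=
    (summable_nat_add_iff 1).2 (summable_geometric_of_lt_one hρ hρ1)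
  have hge : ∀ τ ∈ Metric.ball (0 : ℂ) r, ∀ k : ℕ, 1 - r ≤ ‖(k : ℂ) + 1 - τ‖ := fun τ hτ k => by
    have := one_sub_norm_le τ k
    have := mem_ball_zero_iff.1 hτ
    linarith
  have hd := Complex.differentiableOn_tsum_of_summable_norm (U := Metric.ball (0 : ℂ) r)
    (F := fun (k : ℕ) (τ : ℂ) => (c (k + 1) : ℂ) * (τ / ((k : ℂ) + 1 - τ)))
    (hgρ.mul_right (1 / (1 - r))) (fun k => ?_) Metric.isOpen_ball fun k τ hτ => ?_
  · exact (hd.differentiableAt (Metric.isOpen_ball.mem_nhds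
      (mem_ball_zero_iff.2 hr))).differentiableWithinAt
  · refine DifferentiableOn.const_mul (DifferentiableOn.div (by fun_prop) (by fun_prop)
      fun τ hτ h0 => ?_) _
    have := hge τ hτ k
    rw [h0, norm_zero] at this
    linarith
  · rw [norm_mul, norm_div, Complex.norm_real, Real.norm_eq_abs]
    have h1 : ‖τ‖ ≤ 1 := (mem_ball_zero_iff.1 hτ).le.trans hr1.le
    exact mul_le_mul (hc _) (div_le_div₀ zero_le_one h1 hr0 (hge τ hτ k)) (by positivity)
      (by positivity)

/-- The term `k = 0` of `x * lerchSum c x` equals `c 0 = 1`; the others are the negatives of those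
of `genSum`. -/
lemma genSum_neg_ofReal (hc : ∀ k, |c k| ≤ ρ ^ k) (hρ : 0 ≤ ρ) (hρ1 : ρ < 1) (h0 : c 0 = 1)
    {x : ℝ} (hx : 0 < x) : genSum c (-(x : ℂ)) = ((1 - x * lerchSum c x : ℝ) : ℂ) := by
  have h := (summable_lerchTerm hc hρ hρ1 hx).tsum_eq_zero_add
  have h1 : x * lerchSum c x = 1 + ∑' k : ℕ, x * (c (k + 1) / ((k + 1 : ℕ) + x)) := by
    rw [lerchSum, h, h0, tsum_mul_left]
    push_cast
    field_simp
    ring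
  rw [h1, genSum, sub_add_cancel_left, ← tsum_neg, Complex.ofReal_tsum]
  congr 1
  ext k
  push_cast
  rw [sub_neg_eq_add]
  ring

end generating

/-! ### Real parts of polylogarithms and the two ladders. -/

lemma re_polyLi {z : ℂ} (hz : ‖z‖ < 1) (n : ℕ) :
    (polyLi n z).re = dirSum (fun k => (z ^ k).re) n := by
  have hs : Summable fun k : ℕ => z ^ (k + 1) / ((k : ℂ) + 1) ^ n := by
    refine Summable.of_norm_bounded ((summable_nat_add_iff 1).2
      (summable_geometric_of_lt_one (norm_nonneg z) hz)) fun k => ?_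
    have h : ‖(k : ℂ) + 1‖ = (k : ℝ) + 1 := by
      exact_mod_cast Complex.norm_natCast (k + 1)
    rw [norm_div, norm_pow, norm_pow, h]
    exact div_le_self (by positivity) (one_le_pow₀ (by simp))
  rw [polyLi, Complex.re_tsum hs, dirSum]
  congr 1
  ext k
  rw [← Complex.div_ofReal_re]
  push_cast
  rfl

lemma re_polyLi_of_sq_real {z : ℂ} {q : ℝ} (hz : ‖z‖ < 1) (hre : z.re = 0)
    (hq : z ^ 2 = (q : ℂ)) (n : ℕ) :
    (polyLi n z).re = (1 / 2) ^ n * dirSum (fun k => q ^ k) n := by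
  rw [re_polyLi hz, dirSum, dirSum, ← tsum_mul_left]
  -- The index `k` carries the exponent `k + 1`, so odd indices are the even powers of `z`; odd
  -- powers are purely imaginary and drop out.
  have hinj : Function.Injective fun m : ℕ => 2 * m + 1 := fun a b h => by
    simp only at h
    omega
  rw [← hinj.tsum_eq]
  · congr 1
    ext m
    rw [show 2 * m + 1 + 1 = 2 * (m + 1) by ring, pow_mul, hq, ← Complex.ofReal_pow,
      Complex.ofReal_re]
    push_cast
    rw [show 2 * (m : ℝ) + 1 + 1 = 2 * (m + 1) by ring, mul_pow, one_div, inv_pow]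
    field_simp
  · intro k hk
    rcases Nat.even_or_odd' k with ⟨m, rfl | rfl⟩
    · exfalso
      apply hk
      simp only
      rw [pow_succ, pow_mul, hq, ← Complex.ofReal_pow, Complex.re_ofReal_mul, hre, mul_zero,
        zero_div]
    · exact ⟨m, rfl⟩

lemma sq_ofReal_sqrt (x : ℝ) (hx : 0 ≤ x) : (Real.sqrt x : ℂ) ^ 2 = (x : ℂ) := by
  exact_mod_cast congrArg (fun y : ℝ => (y : ℂ)) (Real.sq_sqrt hx)

lemma norm_lt_one_of_sq {z : ℂ} {q : ℝ} (hq : z ^ 2 = (q : ℂ)) (h : |q| < 1) : ‖z‖ < 1 := by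
  have : ‖z‖ ^ 2 < 1 := by rwa [← norm_pow, hq, Complex.norm_real, Real.norm_eq_abs]
  exact (sq_lt_one_iff₀ (norm_nonneg _)).1 this

lemma ladderC_succ (n : ℕ) : ladderC (n + 1) =
    3 / 2 * (1 / 3) ^ (n + 1) * dirSum (fun k => (-1 / 8) ^ k) (n + 1)
      - dirSum (fun k => (-1 / 2) ^ k) (n + 1) := by
  have h8 : (Complex.I / (Real.sqrt 8 : ℂ)) ^ 2 = ((-1 / 8 : ℝ) : ℂ) := by
    rw [div_pow, sq_ofReal_sqrt 8 (by norm_num), Complex.I_sq]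
    push_cast
    ring
  have h2 : (-Complex.I / (Real.sqrt 2 : ℂ)) ^ 2 = ((-1 / 2 : ℝ) : ℂ) := by
    rw [div_pow, sq_ofReal_sqrt 2 (by norm_num), neg_sq, Complex.I_sq]
    push_cast
    ring
  have e8 := re_polyLi_of_sq_real (norm_lt_one_of_sq h8 (by norm_num [abs_div]))
    (by rw [Complex.div_ofReal_re]; simp) h8 (n + 1)
  have e2 := re_polyLi_of_sq_real (norm_lt_one_of_sq h2 (by norm_num [abs_div]))
    (by rw [Complex.div_ofReal_re]; simp) h2 (n + 1)
  have hz : (2 / 3 : ℂ) ^ (((n + 1 : ℕ) : ℤ) - 1) = (((2 / 3) ^ n : ℝ) : ℂ) := by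
    push_cast
    rw [add_sub_cancel_right, zpow_natCast]
  have hz2 : (2 : ℂ) ^ (n + 1) = (((2 : ℝ) ^ (n + 1) : ℝ) : ℂ) := by push_cast; rfl
  rw [ladderC, hz, hz2, Complex.sub_re, Complex.re_ofReal_mul, Complex.re_ofReal_mul, e8, e2,
    ← mul_assoc, ← mul_assoc, ← mul_pow]
  -- Halving the argument exponent contributes `(1/2)^(n+1)`, which turns the weight into a power of
  -- `1/3`: the generating function is taken at `t / 3`.
  have h1 : (2 / 3 : ℝ) ^ n * (1 / 2) ^ (n + 1) = 3 / 2 * (1 / 3) ^ (n + 1) := by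
    rw [pow_succ, ← mul_assoc, ← mul_pow, pow_succ]
    norm_num
    ring
  rw [h1]
  norm_num

lemma ladderD_succ (n : ℕ) : ladderD (n + 1) =
    3 / 2 * (2 / 3) ^ (n + 1) * dirSum rePow (n + 1)
      - (1 / 2) ^ (n + 1) * dirSum (fun k => (-1 / 4) ^ k) (n + 1) := by
  have h4 : (-Complex.I / 2) ^ 2 = ((-1 / 4 : ℝ) : ℂ) := by
    rw [div_pow, neg_sq, Complex.I_sq]
    push_cast
    ring
  have e4 := re_polyLi_of_sq_real (norm_lt_one_of_sq h4 (by norm_num [abs_div]))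
    (by simp) h4 (n + 1)
  have e1 := re_polyLi (norm_one_add_I_div_four.trans_lt (by norm_num)) (n + 1)
  have hz : (2 / 3 : ℂ) ^ (((n + 1 : ℕ) : ℤ) - 1) = (((2 / 3) ^ n : ℝ) : ℂ) := by
    push_cast
    rw [add_sub_cancel_right, zpow_natCast]
  rw [ladderD, hz, Complex.sub_re, Complex.re_ofReal_mul, e4, e1]
  change (2 / 3 : ℝ) ^ n * dirSum rePow (n + 1) - _ = _
  rw [pow_succ (2 / 3 : ℝ) n]
  ring

lemma abs_neg_eighth_pow_le : ∀ k, |(-1 / 8 : ℝ) ^ k| ≤ (1 / 8) ^ k :=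
  abs_pow_le_of_abs_eq (by norm_num [abs_div])

lemma abs_neg_half_pow_le : ∀ k, |(-1 / 2 : ℝ) ^ k| ≤ (1 / 2) ^ k :=
  abs_pow_le_of_abs_eq (by norm_num [abs_div])

lemma abs_neg_quarter_pow_le : ∀ k, |(-1 / 4 : ℝ) ^ k| ≤ (1 / 4) ^ k :=
  abs_pow_le_of_abs_eq (by norm_num [abs_div])

lemma hasSum_ladderC {t : ℂ} (ht : ‖t‖ < 1) :
    HasSum (fun n : ℕ => (ladderC (n + 1) : ℂ) * t ^ (n + 1))
      (3 / 2 * genSum (fun k => (-1 / 8) ^ k) (t / 3) - genSum (fun k => (-1 / 2) ^ k) t) := by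
  have ht3 : ‖t / 3‖ < 1 := by rw [norm_div]; norm_num; linarith
  have h8 := hasSum_dirSum_mul_pow abs_neg_eighth_pow_le (by norm_num) (by norm_num) ht3
  have h2 := hasSum_dirSum_mul_pow abs_neg_half_pow_le (by norm_num) (by norm_num) ht
  refine (congrArg (HasSum · _) (funext fun n => ?_)).mp ((h8.mul_left (3 / 2)).sub h2)
  rw [ladderC_succ]
  push_cast
  ring

lemma hasSum_ladderD {t : ℂ} (ht : ‖t‖ < 3 / 2) :
    HasSum (fun n : ℕ => (ladderD (n + 1) : ℂ) * t ^ (n + 1))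
      (3 / 2 * genSum rePow (2 * t / 3) - genSum (fun k => (-1 / 4) ^ k) (t / 2)) := by
  have ht3 : ‖2 * t / 3‖ < 1 := by rw [norm_div, norm_mul]; norm_num; linarith
  have ht2 : ‖t / 2‖ < 1 := by rw [norm_div]; norm_num; linarith
  have h8 := hasSum_dirSum_mul_pow abs_rePow_le (by norm_num) (by norm_num) ht3
  have h2 := hasSum_dirSum_mul_pow abs_neg_quarter_pow_le (by norm_num) (by norm_num) ht2
  refine (congrArg (HasSum · _) (funext fun n => ?_)).mp ((h8.mul_left (3 / 2)).sub h2)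
  rw [ladderD_succ]
  push_cast
  ring

/-! ### Restriction to the negative axis and analytic continuation. -/

/-- At `t = -6v` the factor `-t / (2k - t)` is `6v / (2k + 6v)`, which is also correct at `k = 0`,
where it equals `1`. -/
lemma hyp3F2_neg_ofReal (a b : ℝ) {v : ℝ} (hv : 0 < v) {t a' b' : ℂ}
    (ht : t = -((6 * v : ℝ) : ℂ)) (ha : a' = (a : ℂ)) (hb : b' = (b : ℂ)) :
    hyp3F2 (-t / 2) a' 1 (1 - t / 2) b' 1 =
      ((6 * v * ∑' k : ℕ, pochRatio a b k / (2 * k + 6 * v) : ℝ) : ℂ) := by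
  subst ht ha hb
  rw [hyp3F2, ← tsum_mul_left, Complex.ofReal_tsum]
  congr 1
  ext k
  cases k with
  | zero =>
    rw [hyp3F2Term_zero, pochRatio_zero]
    have : 6 * v * (1 / (2 * ((0 : ℕ) : ℝ) + 6 * v)) = 1 := by
      push_cast
      field_simp
      simp
    rw [this, Complex.ofReal_one]
  | succ k =>
    rw [hyp3F2Term_succ _ _ _ (by simp; linarith)]
    push_cast [ofReal_pochRatio]
    rw [sub_neg_eq_add]
    ring

/-- Holomorphic functions on a disc that agree on the negative radius agree. -/
lemma eqOn_ball_of_eq_neg_real {f g : ℂ → ℂ} {R : ℝ} (hR : 0 < R)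
    (hf : DifferentiableOn ℂ f (Metric.ball 0 R)) (hg : DifferentiableOn ℂ g (Metric.ball 0 R))
    (h : ∀ v : ℝ, 0 < v → f (-((6 * v : ℝ) : ℂ)) = g (-((6 * v : ℝ) : ℂ))) :
    Set.EqOn f g (Metric.ball 0 R) := by
  refine (hf.analyticOnNhd Metric.isOpen_ball).eqOn_of_preconnected_of_frequently_eq
    (hg.analyticOnNhd Metric.isOpen_ball) (convex_ball _ _).isPreconnected
    (Metric.mem_ball_self hR) ?_
  -- The points `-6v` approach the centre of the disc without meeting it, so agreement there is
  -- frequent near `0`.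
  have hlim : Tendsto (fun v : ℝ => -((6 * v : ℝ) : ℂ)) (𝓝[>] 0) (𝓝[≠] 0) := by
    refine tendsto_nhdsWithin_iff.2 ⟨?_, ?_⟩
    · have : Continuous fun v : ℝ => -((6 * v : ℝ) : ℂ) := by fun_prop
      simpa using (this.tendsto 0).mono_left nhdsWithin_le_nhds
    · filter_upwards [self_mem_nhdsWithin] with v hv
      have hv : 0 < v := hv
      simp [hv.ne']
  refine hlim.frequently (Eventually.frequently ?_)
  filter_upwards [self_mem_nhdsWithin] with v hv using h v hv

lemma ball_subset_re_lt (R : ℝ) : Metric.ball (0 : ℂ) R ⊆ {t : ℂ | t.re < R} := fun t ht =>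
  (Complex.re_le_norm t).trans_lt (mem_ball_zero_iff.1 ht)

lemma two_mul_tsum_ladderC {t : ℂ} (ht : ‖t‖ < 1) :
    2 * ∑' n : ℕ, (ladderC (n + 1) : ℂ) * t ^ (n + 1) =
      1 - hyp3F2 (-t / 2) (1 / 2 - t / 6) 1 (1 - t / 2) (1 - 2 * t / 3) 1 := by
  rw [(hasSum_ladderC ht).tsum_eq]
  have hd := (differentiableOn_hyp3F2 (A := fun t => 1 / 2 - t / 6) (α := 1 / 6) (X := 1)
    (fun t => by push_cast; ring) (by norm_num [abs_div]) (by norm_num) (by norm_num)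
    (by norm_num)).mono (ball_subset_re_lt 1)
  have h8 : DifferentiableOn ℂ (fun t : ℂ => genSum (fun k => (-1 / 8) ^ k) (t / 3))
      (Metric.ball 0 1) :=
    (differentiableOn_genSum abs_neg_eighth_pow_le (by norm_num) (by norm_num)).comp
      (by fun_prop) fun t ht => by
        rw [mem_ball_zero_iff] at ht ⊢
        rw [norm_div]; norm_num; linarith
  have h2 := differentiableOn_genSum abs_neg_half_pow_le (by norm_num) (by norm_num)
  refine eqOn_ball_of_eq_neg_real one_pos (f := fun t => 2 * (3 / 2 *
    genSum (fun k => (-1 / 8) ^ k) (t / 3) - genSum (fun k => (-1 / 2) ^ k) t))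
    (((h8.const_mul _).sub h2).const_mul _) (hd.const_sub 1) (fun v hv => ?_)
    (mem_ball_zero_iff.2 ht)
  -- Each of the two values `1 - x * lerchSum` enters with its weight: the constants give `2 * (3/2
  -- - 1) = 1`, and the rest is `6v` times `tsum_termC`.
  rw [hyp3F2_neg_ofReal (1 / 2 + v) (1 + 4 * v) hv rfl (by push_cast; ring) (by push_cast; ring),
    show -((6 * v : ℝ) : ℂ) / 3 = -((2 * v : ℝ) : ℂ) by push_cast; ring,
    genSum_neg_ofReal abs_neg_eighth_pow_le (by norm_num) (by norm_num) (by simp) (by positivity),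
    genSum_neg_ofReal abs_neg_half_pow_le (by norm_num) (by norm_num) (by simp) (by positivity)]
  have h := tsum_termC hv
  simp only [termC] at h
  rw [h]
  push_cast
  ring

lemma two_mul_tsum_ladderD {t : ℂ} (ht : ‖t‖ < 3 / 2) :
    2 * ∑' n : ℕ, (ladderD (n + 1) : ℂ) * t ^ (n + 1) =
      1 - hyp3F2 (-t / 2) (1 / 2 - t / 3) 1 (1 - t / 2) (1 - 2 * t / 3) 1 := by
  rw [(hasSum_ladderD ht).tsum_eq]
  have hd := (differentiableOn_hyp3F2 (A := fun t => 1 / 2 - t / 3) (α := 1 / 3) (X := 3 / 2)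
    (fun t => by push_cast; ring) (by norm_num [abs_div]) (by norm_num) (by norm_num)
    (by norm_num)).mono (ball_subset_re_lt (3 / 2))
  have h8 : DifferentiableOn ℂ (fun t : ℂ => genSum rePow (2 * t / 3)) (Metric.ball 0 (3 / 2)) :=
    (differentiableOn_genSum abs_rePow_le (by norm_num) (by norm_num)).comp
      (by fun_prop) fun t ht => by
        rw [mem_ball_zero_iff] at ht ⊢
        rw [norm_div, norm_mul]; norm_num; linarith
  have h2 : DifferentiableOn ℂ (fun t : ℂ => genSum (fun k => (-1 / 4) ^ k) (t / 2))
      (Metric.ball 0 (3 / 2)) :=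
    (differentiableOn_genSum abs_neg_quarter_pow_le (by norm_num) (by norm_num)).comp
      (by fun_prop) fun t ht => by
        rw [mem_ball_zero_iff] at ht ⊢
        rw [norm_div]; norm_num; linarith
  refine eqOn_ball_of_eq_neg_real (by norm_num) (f := fun t => 2 * (3 / 2 *
    genSum rePow (2 * t / 3) - genSum (fun k => (-1 / 4) ^ k) (t / 2)))
    (((h8.const_mul _).sub h2).const_mul _) (hd.const_sub 1) (fun v hv => ?_)
    (mem_ball_zero_iff.2 ht)
  rw [hyp3F2_neg_ofReal (1 / 2 + 2 * v) (1 + 4 * v) hv rfl (by push_cast; ring)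
      (by push_cast; ring),
    show 2 * -((6 * v : ℝ) : ℂ) / 3 = -((4 * v : ℝ) : ℂ) by push_cast; ring,
    show -((6 * v : ℝ) : ℂ) / 2 = -((3 * v : ℝ) : ℂ) by push_cast; ring,
    genSum_neg_ofReal abs_rePow_le (by norm_num) (by norm_num) (by simp [rePow]) (by positivity),
    genSum_neg_ofReal abs_neg_quarter_pow_le (by norm_num) (by norm_num) (by simp)
      (by positivity)]
  have h := tsum_termD hv
  simp only [termD] at h
  rw [h]
  push_cast
  ring

end

theorem mainTheorem6 :
    ((∀ t : ℂ, t.re < 1 →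
        Summable (hyp3F2Term (-t / 2) (1 / 2 - t / 6) 1 (1 - t / 2) (1 - 2 * t / 3) 1)) ∧
      DifferentiableOn ℂ
        (fun t : ℂ => hyp3F2 (-t / 2) (1 / 2 - t / 6) 1 (1 - t / 2) (1 - 2 * t / 3) 1)
        {t : ℂ | t.re < 1} ∧
      ∀ t : ℂ, ‖t‖ < 1 →
        Summable (fun n : ℕ => (ladderC (n + 1) : ℂ) * t ^ (n + 1)) ∧
        2 * ∑' n : ℕ, (ladderC (n + 1) : ℂ) * t ^ (n + 1) =
          1 - hyp3F2 (-t / 2) (1 / 2 - t / 6) 1 (1 - t / 2) (1 - 2 * t / 3) 1) ∧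
    ((∀ t : ℂ, t.re < 3 / 2 →
        Summable (hyp3F2Term (-t / 2) (1 / 2 - t / 3) 1 (1 - t / 2) (1 - 2 * t / 3) 1)) ∧
      DifferentiableOn ℂ
        (fun t : ℂ => hyp3F2 (-t / 2) (1 / 2 - t / 3) 1 (1 - t / 2) (1 - 2 * t / 3) 1)
        {t : ℂ | t.re < 3 / 2} ∧
      ∀ t : ℂ, ‖t‖ < 3 / 2 →
        Summable (fun n : ℕ => (ladderD (n + 1) : ℂ) * t ^ (n + 1)) ∧
        2 * ∑' n : ℕ, (ladderD (n + 1) : ℂ) * t ^ (n + 1) =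
          1 - hyp3F2 (-t / 2) (1 / 2 - t / 3) 1 (1 - t / 2) (1 - 2 * t / 3) 1) := by
  refine ⟨⟨fun t ht => ?_, ?_, fun t ht => ⟨(hasSum_ladderC ht).summable, two_mul_tsum_ladderC ht⟩⟩,
    fun t ht => ?_, ?_, fun t ht => ⟨(hasSum_ladderD ht).summable, two_mul_tsum_ladderD ht⟩⟩
  · exact summable_hyp3F2Term (A := fun t => 1 / 2 - t / 6) (α := 1 / 6)
      (fun t => by push_cast; ring) (by norm_num [abs_div]) (by norm_num) (by norm_num)
      (by norm_num) ht
  · exact differentiableOn_hyp3F2 (A := fun t => 1 / 2 - t / 6) (α := 1 / 6)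
      (fun t => by push_cast; ring) (by norm_num [abs_div]) (by norm_num) (by norm_num)
      (by norm_num)
  · exact summable_hyp3F2Term (A := fun t => 1 / 2 - t / 3) (α := 1 / 3)
      (fun t => by push_cast; ring) (by norm_num [abs_div]) (by norm_num) (by norm_num)
      (by norm_num) ht
  · exact differentiableOn_hyp3F2 (A := fun t => 1 / 2 - t / 3) (α := 1 / 3)
      (fun t => by push_cast; ring) (by norm_num [abs_div]) (by norm_num) (by norm_num)
      (by norm_num)
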